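/- Let $n \ge 3$ and let $E_n(x) = \dfrac{-1}{(n-2)\,\omega_{n-1}}\,\dfrac{1}{|x|^{n-2}}$ for $x \in \mathbb{R}^n \setminus \{0\}$, where $\omega_{n-1}$ is the surface area of the unit sphere in $\mathbb{R}^n$. Let $f : \mathbb{R}^n \to \mathbb{R}$ be of class $\mathcal{C}^1(\mathbb{R}^n)$ and suppose that $$\frac{f(y)}{1+|y|^{n-2}} \in L^1(\mathbb{R}^n) \qquad\text{and}\qquad \frac{\nabla f(y)}{1+|y|^{n-1}} \in L^1(\mathbb{R}^n).$$ Then for every $x \in \mathbb{R}^n$ the integral $$u(x) := \int_{\mathbb{R}^n} E_n(x-y)\, f(y)\, dy$$ converges absolutely, and $u \in \mathcal{C}^2(\mathbb{R}^n)$. Moreover, for all $i, j \in \{1,\dots,n\}$ and all $x \in \mathbb{R}^n$, $$\partial_i \partial_j u(x) = \int_{\mathbb{R}^n} \partial_j E_n(x-y)\, \partial_i f(y)\, dy,$$ where the integral converges absolutely. Furthermore, $\Delta u(x) = f(x)$ for every $x \in \mathbb{R}^n$. -/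

import Mathlib

open MeasureTheory InnerProductSpace
open scoped Gradient Laplacian

noncomputable section

/-- The surface area of the unit sphere of `ℝⁿ` (written `ω_{n-1}`), as the total mass of the surface
measure induced on the sphere by Lebesgue measure. -/
def sphereArea (n : ℕ) : ℝ :=
  (volume : Measure (EuclideanSpace ℝ (Fin n))).toSphere.real Set.univ

/-- The fundamental solution of the Laplacian in `ℝⁿ`, for `n ≥ 3`:
`E_n(x) = -1 / ((n - 2) ω_{n-1}) * 1 / |x|^{n-2}` for `x ≠ 0`. Its value at the origin (here `0`) is
irrelevant. -/
def fundamentalSolution (n : ℕ) (x : EuclideanSpace ℝ (Fin n)) : ℝ :=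
  -1 / (((n : ℝ) - 2) * sphereArea n) * (1 / ‖x‖ ^ (n - 2))

/-- The partial derivative `∂_i g (x)`, the derivative of `t ↦ g (x + t e_i)` at `t = 0`. -/
def partialDeriv {n : ℕ} (i : Fin n) (g : EuclideanSpace ℝ (Fin n) → ℝ)
    (x : EuclideanSpace ℝ (Fin n)) : ℝ :=
  lineDeriv ℝ g x (EuclideanSpace.single i 1)

/-- The Newton potential `u(x) = (E_n * f)(x) = ∫ E_n(x - y) f(y) dy`. -/
def newtonPotential {n : ℕ} (f : EuclideanSpace ℝ (Fin n) → ℝ)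
    (x : EuclideanSpace ℝ (Fin n)) : ℝ :=
  ∫ y, fundamentalSolution n (x - y) * f y

end

/-! ### Continuity of potentials, jointly in the point and a kernel parameter. -/

section PotentialContinuity

open Filter Set Metric Module
open scoped Topology

variable {V : Type*} [NormedAddCommGroup V]

/-! Write `n = m + 2` and replace `1 / ‖z‖ ^ m` by `regKernel m ε z`, a power of `√(ε² + ‖z‖²)`. For
`ε ≠ 0` nothing is singular: the potential is differentiated under the integral, and in the second
derivative one derivative is moved onto `f` by parts (`integral_smul_fderiv_sub_eq`), leaving `∇f`
against the kernel's gradient.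

The kernel and its gradient have orders `m` and `m + 1`, both below `n`, so these integrals are
continuous in `(ε, x)` up to `ε = 0` (`integrable_and_continuous_integral_of_singular`). Joint
continuity makes the derivatives converge locally uniformly, so the derivative formulas survive at
`ε = 0` (`hasFDerivAt_zero_of_continuous_parameter`); this gives `C²` and the formula for `∂_i ∂_j
u`.

For the Laplacian, the trace of the regularised Hessian is a multiple of `ε² (ε² + ‖z‖²) ^ (-(n + 2)
/ 2)` (`sum_regHess_apply`), an approximate identity of mass `vol (ball 0 1)`
(`tendsto_integral_regKernel`). The area `n * vol (ball 0 1)` of the sphere normalises the limit to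
`f x`. -/

lemma one_add_norm_pow_le_mul_one_add_norm_sub_pow (m : ℕ) {R : ℝ} {x : V} (hx : ‖x‖ ≤ R) (y : V) :
    1 + ‖y‖ ^ m ≤ (1 + (2 * (1 + R)) ^ m) * (1 + ‖x - y‖ ^ m) := by
  have hR : 0 ≤ R := (norm_nonneg x).trans hx
  have h1 : ‖y‖ ≤ 2 * (1 + R) * max 1 ‖x - y‖ := by
    have h2 : ‖y‖ ≤ ‖x‖ + ‖x - y‖ := by
      simpa using norm_sub_le x (x - y)
    have h3 := le_max_left 1 ‖x - y‖
    have h4 := le_max_right 1 ‖x - y‖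
    nlinarith
  have h2 : ‖y‖ ^ m ≤ (2 * (1 + R)) ^ m * (max 1 ‖x - y‖) ^ m := by
    rw [← mul_pow]
    exact pow_le_pow_left₀ (norm_nonneg y) h1 m
  have h3 : (max 1 ‖x - y‖) ^ m ≤ 1 + ‖x - y‖ ^ m := by
    rcases max_choice 1 ‖x - y‖ with h | h <;> rw [h]
    · simp
    · simp
  have h4 : (0 : ℝ) ≤ (2 * (1 + R)) ^ m := by positivity
  have h5 : (0 : ℝ) ≤ ‖x - y‖ ^ m := by positivity
  nlinarith [mul_le_mul_of_nonneg_left h3 h4]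

/-- Exchanges the weight at `x - y` for the weight at `y` at a cost uniform over bounded `x`, which
supplies dominating functions independent of `x`. -/
lemma div_one_add_norm_sub_pow_le (m : ℕ) {R a : ℝ} (ha : 0 ≤ a) {x : V} (hx : ‖x‖ ≤ R) (y : V) :
    a / (1 + ‖x - y‖ ^ m) ≤ (1 + (2 * (1 + R)) ^ m) * (a / (1 + ‖y‖ ^ m)) := by
  rw [mul_div_assoc', div_le_div_iff₀ (by positivity) (by positivity)]
  have := mul_le_mul_of_nonneg_left (one_add_norm_pow_le_mul_one_add_norm_sub_pow m hx y) ha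
  linarith

variable [NormedSpace ℝ V] [FiniteDimensional ℝ V] [MeasurableSpace V] [BorelSpace V]
  {μ : Measure V} [μ.IsAddHaarMeasure]
  {W₁ W₂ W₃ : Type*} [NormedAddCommGroup W₁] [NormedSpace ℝ W₁] [NormedAddCommGroup W₂]
  [NormedSpace ℝ W₂] [NormedAddCommGroup W₃] [NormedSpace ℝ W₃]

lemma aestronglyMeasurable_of_continuousAt_compl_singleton [Nontrivial V] {W : Type*}
    [TopologicalSpace W] [TopologicalSpace.PseudoMetrizableSpace W] {k : V → W} {x : V}
    (hk : ∀ z, z ≠ x → ContinuousAt k z) : AEStronglyMeasurable k μ := by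
  have h : ContinuousOn k ({x}ᶜ : Set V) := fun z hz => (hk z hz).continuousWithinAt
  have h1 := h.aestronglyMeasurable (μ := μ) (measurableSet_singleton x).compl
  rwa [restrict_compl_singleton] at h1

lemma aestronglyMeasurable_bilin_sub [Nontrivial V] {k : V → W₁} (hk : ∀ z, z ≠ 0 → ContinuousAt k z)
    {g : V → W₂} (hg : Continuous g) (L : W₁ →L[ℝ] W₂ →L[ℝ] W₃) (x : V) :
    AEStronglyMeasurable (fun y => L (k (x - y)) (g y)) μ := by
  refine aestronglyMeasurable_of_continuousAt_compl_singleton (x := x) fun y hy => ?_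
  have h : ContinuousAt (fun y => k (x - y)) y :=
    ContinuousAt.comp (f := fun y => x - y) (hk _ (sub_ne_zero.2 hy.symm)) (by fun_prop)
  exact (L.continuous.continuousAt.comp h).clm_apply hg.continuousAt

lemma ae_ne_of_nontrivial [Nontrivial V] (x : V) : ∀ᵐ y ∂μ, y ≠ x :=
  compl_mem_ae_iff.2 (measure_singleton x)

theorem integrable_and_continuous_integral_of_decay [Nontrivial V]
    {K : ℝ → V → W₁} {m : ℕ} {C : ℝ}
    (hK : ∀ ε z, z ≠ 0 → ContinuousAt (fun p : ℝ × V => K p.1 p.2) (ε, z))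
    (hb : ∀ ε z, z ≠ 0 → ‖K ε z‖ ≤ C / (1 + ‖z‖ ^ m))
    {g : V → W₂} (hg : Continuous g) (hgi : Integrable (fun y => ‖g y‖ / (1 + ‖y‖ ^ m)) μ)
    (L : W₁ →L[ℝ] W₂ →L[ℝ] W₃) :
    (∀ ε x, Integrable (fun y => L (K ε (x - y)) (g y)) μ) ∧
    Continuous (fun p : ℝ × V => ∫ y, L (K p.1 (p.2 - y)) (g y) ∂μ) := by
  have hC : 0 ≤ C := by
    obtain ⟨z, hz⟩ := exists_ne (0 : V)
    have := (norm_nonneg _).trans (hb 0 z hz)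
    by_contra hneg
    exact absurd this (not_le.2 (div_neg_of_neg_of_pos (not_le.1 hneg) (by positivity)))
  have hK' : ∀ ε z, z ≠ 0 → ContinuousAt (K ε) z := fun ε z hz =>
    ContinuousAt.comp (f := fun z => (ε, z)) (hK ε z hz) (by fun_prop)
  have hbound : ∀ (R : ℝ) (ε : ℝ) (x : V), ‖x‖ ≤ R → ∀ y, y ≠ x → ‖L (K ε (x - y)) (g y)‖ ≤
      ‖L‖ * C * (1 + (2 * (1 + R)) ^ m) * (‖g y‖ / (1 + ‖y‖ ^ m)) := by
    intro R ε x hx y hy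
    calc ‖L (K ε (x - y)) (g y)‖ ≤ ‖L‖ * ‖K ε (x - y)‖ * ‖g y‖ := L.le_opNorm₂ _ _
      _ ≤ ‖L‖ * (C / (1 + ‖x - y‖ ^ m)) * ‖g y‖ := by
        gcongr
        exact hb _ _ (sub_ne_zero.2 hy.symm)
      _ = ‖L‖ * C * (‖g y‖ / (1 + ‖x - y‖ ^ m)) := by ring
      _ ≤ ‖L‖ * C * ((1 + (2 * (1 + R)) ^ m) * (‖g y‖ / (1 + ‖y‖ ^ m))) := by
        gcongr
        exact div_one_add_norm_sub_pow_le m (norm_nonneg _) hx y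
      _ = _ := by ring
  have hmeas : ∀ ε x, AEStronglyMeasurable (fun y => L (K ε (x - y)) (g y)) μ :=
    fun ε x => aestronglyMeasurable_bilin_sub (hK' ε) hg L x
  refine ⟨fun ε x => ?_, ?_⟩
  · refine Integrable.mono' (hgi.const_mul (‖L‖ * C * (1 + (2 * (1 + ‖x‖)) ^ m))) (hmeas ε x) ?_
    filter_upwards [ae_ne_of_nontrivial x] with y hy using hbound ‖x‖ ε x le_rfl y hy
  · refine continuous_iff_continuousAt.2 fun ⟨ε₀, x₀⟩ => ?_
    refine continuousAt_of_dominated (.of_forall fun p => hmeas p.1 p.2) ?_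
      (hgi.const_mul (‖L‖ * C * (1 + (2 * (1 + (‖x₀‖ + 1))) ^ m))) ?_
    · have : ∀ᶠ p : ℝ × V in 𝓝 (ε₀, x₀), ‖p.2‖ ≤ ‖x₀‖ + 1 :=
        (continuous_snd.norm.tendsto (ε₀, x₀)).eventually_le_const (by simp)
      filter_upwards [this] with p hp
      filter_upwards [ae_ne_of_nontrivial p.2] with y hy using hbound _ _ _ hp y hy
    · filter_upwards [ae_ne_of_nontrivial x₀] with y hy
      have h : ContinuousAt (fun p : ℝ × V => K p.1 (p.2 - y)) (ε₀, x₀) :=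
        ContinuousAt.comp (x := (ε₀, x₀)) (g := fun p : ℝ × V => K p.1 p.2)
          (f := fun p : ℝ × V => (p.1, p.2 - y))
          (hK ε₀ (x₀ - y) (sub_ne_zero.2 hy.symm)) (by fun_prop)
      exact (L.continuous.continuousAt.comp h).clm_apply continuousAt_const

/-- No decay of `g` is needed: only its values on a compact ball enter, where it is bounded. -/
theorem integrable_and_continuous_integral_of_local [Nontrivial V]
    {K : ℝ → V → W₁} {b : V → ℝ}
    (hK : ∀ ε z, z ≠ 0 → ContinuousAt (fun p : ℝ × V => K p.1 p.2) (ε, z))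
    (hb : ∀ ε z, z ≠ 0 → ‖K ε z‖ ≤ b z) (hbi : Integrable b μ) (hb0 : ∀ z, 1 < ‖z‖ → b z = 0)
    {g : V → W₂} (hg : Continuous g) (L : W₁ →L[ℝ] W₂ →L[ℝ] W₃) :
    (∀ ε x, Integrable (fun y => L (K ε (x - y)) (g y)) μ) ∧
    Continuous (fun p : ℝ × V => ∫ y, L (K p.1 (p.2 - y)) (g y) ∂μ) := by
  have hK' : ∀ ε z, z ≠ 0 → ContinuousAt (K ε) z := fun ε z hz =>
    ContinuousAt.comp (f := fun z => (ε, z)) (hK ε z hz) (by fun_prop)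
  have hmeas : ∀ ε x, AEStronglyMeasurable (fun z => L (K ε z) (g (x - z))) μ := by
    intro ε x
    refine aestronglyMeasurable_of_continuousAt_compl_singleton (x := 0) fun z hz => ?_
    exact (L.continuous.continuousAt.comp (hK' ε z hz)).clm_apply (by fun_prop)
  have hbound : ∀ R : ℝ, ∃ M : ℝ, ∀ (ε : ℝ) (x : V), ‖x‖ ≤ R → ∀ z, z ≠ 0 →
      ‖L (K ε z) (g (x - z))‖ ≤ ‖L‖ * b z * M := by
    intro R
    obtain ⟨M, hM⟩ := (isCompact_closedBall (0 : V) (R + 1)).exists_bound_of_continuousOn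
      hg.continuousOn
    refine ⟨M, fun ε x hx z hz => ?_⟩
    have hbz : 0 ≤ b z := (norm_nonneg _).trans (hb ε z hz)
    by_cases h1 : 1 < ‖z‖
    · have hKz : K ε z = 0 := by simpa [hb0 z h1] using hb ε z hz
      simp [hKz, hb0 z h1]
    · have hz' : ‖g (x - z)‖ ≤ M := hM _ (by
        rw [mem_closedBall_zero_iff]
        linarith [norm_sub_le x z, not_lt.1 h1])
      calc _ ≤ ‖L‖ * ‖K ε z‖ * ‖g (x - z)‖ := L.le_opNorm₂ _ _
        _ ≤ ‖L‖ * b z * M := by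
          gcongr
          exact hb ε z hz
  have hint : ∀ ε x, Integrable (fun z => L (K ε z) (g (x - z))) μ := by
    intro ε x
    obtain ⟨M, hM⟩ := hbound ‖x‖
    refine Integrable.mono' ((hbi.const_mul ‖L‖).mul_const M) (hmeas ε x) ?_
    filter_upwards [ae_ne_of_nontrivial 0] with z hz using hM ε x le_rfl z hz
  -- Substituting `z = x - y` fixes the singularity at the origin, so that one integrable function
  -- `b` dominates for all nearby `x`.
  have heq : ∀ ε x, ∫ y, L (K ε (x - y)) (g y) ∂μ = ∫ z, L (K ε z) (g (x - z)) ∂μ := by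
    intro ε x
    rw [← integral_sub_left_eq_self (fun z => L (K ε z) (g (x - z))) μ x]
    simp
  refine ⟨fun ε x => ?_, ?_⟩
  · simpa using (hint ε x).comp_sub_left x
  · simp_rw [heq]
    refine continuous_iff_continuousAt.2 fun ⟨ε₀, x₀⟩ => ?_
    obtain ⟨M, hM⟩ := hbound (‖x₀‖ + 1)
    refine continuousAt_of_dominated (.of_forall fun p => hmeas p.1 p.2) ?_
      ((hbi.const_mul ‖L‖).mul_const M) ?_
    · have : ∀ᶠ p : ℝ × V in 𝓝 (ε₀, x₀), ‖p.2‖ ≤ ‖x₀‖ + 1 :=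
        (continuous_snd.norm.tendsto (ε₀, x₀)).eventually_le_const (by simp)
      filter_upwards [this] with p hp
      filter_upwards [ae_ne_of_nontrivial 0] with z hz using hM _ _ hp z hz
    · filter_upwards [ae_ne_of_nontrivial 0] with z hz
      have h : ContinuousAt (fun p : ℝ × V => K p.1 z) (ε₀, x₀) :=
        ContinuousAt.comp (x := (ε₀, x₀)) (g := fun p : ℝ × V => K p.1 p.2)
          (f := fun p : ℝ × V => (p.1, z)) (hK ε₀ z hz) (by fun_prop)
      exact (L.continuous.continuousAt.comp h).clm_apply (by fun_prop)

/-- In polar coordinates the radial integrand is `C * r ^ (dim - 1 - m)`, with nonnegative exponent.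
-/
lemma integrable_indicator_closedBall_div_norm_pow [Nontrivial V] {m : ℕ} (hm : m < finrank ℝ V)
    (C : ℝ) : Integrable ((closedBall (0 : V) 1).indicator fun z => C / ‖z‖ ^ m) μ := by
  rw [integrable_indicator_iff measurableSet_closedBall]
  refine IntegrableOn.mono_set (t := ball (0 : V) 2) ?_ (closedBall_subset_ball (by norm_num))
  refine (integrableOn_fun_norm_addHaar μ (f := fun r => C / r ^ m)).2 ?_
  refine IntegrableOn.congr_fun (f := fun r => C * r ^ (finrank ℝ V - 1 - m)) ?_ ?_
    measurableSet_Ioo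
  · exact (Continuous.integrableOn_Icc (by fun_prop)).mono_set Ioo_subset_Icc_self
  · intro r hr
    have hr0 : r ≠ 0 := hr.1.ne'
    simp only [smul_eq_mul]
    rw [show finrank ℝ V - 1 = (finrank ℝ V - 1 - m) + m by omega, pow_add]
    field_simp
    simp

/-- Potentials of a kernel with an integrable singularity of order `m` at the origin
depend continuously on the point and on the parameter of the kernel. -/
theorem integrable_and_continuous_integral_of_singular [Nontrivial V]
    {K : ℝ → V → W₁} {m : ℕ} {C : ℝ} (hm : m < finrank ℝ V)
    (hK : ∀ ε z, z ≠ 0 → ContinuousAt (fun p : ℝ × V => K p.1 p.2) (ε, z))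
    (hb : ∀ ε z, z ≠ 0 → ‖K ε z‖ ≤ C / ‖z‖ ^ m)
    {g : V → W₂} (hg : Continuous g) (hgi : Integrable (fun y => ‖g y‖ / (1 + ‖y‖ ^ m)) μ)
    (L : W₁ →L[ℝ] W₂ →L[ℝ] W₃) :
    (∀ ε x, Integrable (fun y => L (K ε (x - y)) (g y)) μ) ∧
    Continuous (fun p : ℝ × V => ∫ y, L (K p.1 (p.2 - y)) (g y) ∂μ) := by
  -- The cutoff `θ = min 1 ‖z‖ ^ m` splits the kernel: `θ K` is bounded by `2 C / (1 + ‖z‖ ^ m)`,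
  -- while `(1 - θ) K` vanishes outside the unit ball and keeps the integrable singularity.
  have hθ : Continuous (fun p : ℝ × V => min 1 ‖p.2‖ ^ m) := by fun_prop
  have hC : 0 ≤ C := by
    obtain ⟨z, hz⟩ := exists_ne (0 : V)
    have := (norm_nonneg _).trans (hb 0 z hz)
    have hz' : 0 < ‖z‖ := norm_pos_iff.2 hz
    by_contra hneg
    exact absurd this (not_le.2 (div_neg_of_neg_of_pos (not_le.1 hneg) (by positivity)))
  have hfar := integrable_and_continuous_integral_of_decay (μ := μ)
    (K := fun ε z => (min 1 ‖z‖ ^ m) • K ε z) (m := m) (C := 2 * C)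
    (fun ε z hz => hθ.continuousAt.smul (hK ε z hz)) (fun ε z hz => by
      have hz' : 0 < ‖z‖ := norm_pos_iff.2 hz
      rw [norm_smul, Real.norm_of_nonneg (by positivity)]
      refine (mul_le_mul_of_nonneg_left (hb ε z hz) (by positivity)).trans ?_
      rw [mul_div_assoc', div_le_div_iff₀ (by positivity) (by positivity)]
      have h1 : min 1 ‖z‖ ^ m ≤ 1 := pow_le_one₀ (by positivity) (min_le_left _ _)
      have h2 : min 1 ‖z‖ ^ m ≤ ‖z‖ ^ m := pow_le_pow_left₀ (by positivity) (min_le_right _ _) m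
      have h3 : 0 ≤ ‖z‖ ^ m := by positivity
      nlinarith [mul_nonneg hC h3, mul_nonneg hC (mul_nonneg h3 (sub_nonneg.2 h1)),
        mul_nonneg hC (sub_nonneg.2 h2)]) hg hgi L
  have hnear := integrable_and_continuous_integral_of_local (μ := μ)
    (K := fun ε z => (1 - min 1 ‖z‖ ^ m) • K ε z)
    (fun ε z hz => (continuousAt_const.sub hθ.continuousAt).smul (hK ε z hz)) (fun ε z hz => by
      have h1 : min 1 ‖z‖ ^ m ≤ 1 := pow_le_one₀ (by positivity) (min_le_left _ _)
      rw [norm_smul, Real.norm_of_nonneg (sub_nonneg.2 h1)]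
      by_cases h : ‖z‖ ≤ 1
      · rw [indicator_of_mem (mem_closedBall_zero_iff.2 h)]
        refine le_trans ?_ (hb ε z hz)
        refine mul_le_of_le_one_left (norm_nonneg _) ?_
        have : 0 ≤ min 1 ‖z‖ ^ m := by positivity
        linarith
      · rw [indicator_of_notMem (by rwa [mem_closedBall_zero_iff]), min_eq_left (not_le.1 h).le]
        simp)
    (integrable_indicator_closedBall_div_norm_pow hm C) (fun z hz => by
      rw [indicator_of_notMem (by rw [mem_closedBall_zero_iff]; exact not_le.2 hz)]) hg L
  have heq : ∀ ε x y, L ((1 - min 1 ‖x - y‖ ^ m) • K ε (x - y)) (g y) +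
      L ((min 1 ‖x - y‖ ^ m) • K ε (x - y)) (g y) = L (K ε (x - y)) (g y) := by
    intro ε x y
    rw [← add_apply, ← map_add, ← add_smul, sub_add_cancel, one_smul]
  refine ⟨fun ε x => ?_, ?_⟩
  · exact ((hnear.1 ε x).add (hfar.1 ε x)).congr (.of_forall fun y => heq ε x y)
  · refine (hnear.2.add hfar.2).congr fun p => ?_
    simp only [Pi.add_apply]
    rw [← integral_add (hnear.1 _ _) (hfar.1 _ _)]
    exact integral_congr_ae (.of_forall fun y => heq _ _ _)

end PotentialContinuity

/-! ### Differentiation under the integral and integration by parts. -/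

section PotentialDerivative

open Filter Set Metric Module ContinuousLinearMap
open scoped Topology

/-- Continuity of `F'` at `(0, x)` makes `F' (ε, ·)` converge uniformly near `x` as `ε → 0`, so
limit and derivative commute. -/
lemma hasFDerivAt_zero_of_continuous_parameter {V W : Type*} [NormedAddCommGroup V]
    [NormedSpace ℝ V] [NormedAddCommGroup W] [NormedSpace ℝ W] {F : ℝ × V → W}
    {F' : ℝ × V → V →L[ℝ] W} (hF : Continuous F) (hF' : Continuous F')
    (h : ∀ ε x, ε ≠ 0 → HasFDerivAt (fun x => F (ε, x)) (F' (ε, x)) x) (x : V) :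
    HasFDerivAt (fun x => F (0, x)) (F' (0, x)) x := by
  refine hasFDerivAt_of_tendstoUniformlyOnFilter (l := 𝓝[≠] (0 : ℝ))
    (f := fun ε x => F (ε, x)) (f' := fun ε x => F' (ε, x)) (g' := fun x => F' (0, x)) ?_ ?_ ?_
  · rw [tendstoUniformlyOnFilter_iff_tendsto]
    have h1 : Tendsto (fun q : ℝ × V => (F' (0, q.2), F' (q.1, q.2))) (𝓝 (0, x))
        (𝓝 (F' (0, x), F' (0, x))) := by
      have : Continuous (fun q : ℝ × V => (F' (0, q.2), F' (q.1, q.2))) := by fun_prop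
      exact this.tendsto (0, x)
    rw [nhds_prod_eq] at h1
    exact (h1.mono_left (prod_mono nhdsWithin_le_nhds le_rfl)).mono_right
      (nhds_le_uniformity _)
  · filter_upwards [(eventually_mem_nhdsWithin (a := (0 : ℝ)) (s := {0}ᶜ)).prod_inl (𝓝 x)] with p hp
    exact h p.1 p.2 hp
  · refine .of_forall fun y => ?_
    have : Continuous (fun ε => F (ε, y)) := by fun_prop
    exact (this.tendsto 0).mono_left nhdsWithin_le_nhds

variable {V : Type*} [NormedAddCommGroup V] [NormedSpace ℝ V] [FiniteDimensional ℝ V]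
  [MeasurableSpace V] [BorelSpace V] {μ : Measure V} [μ.IsAddHaarMeasure]
  {W : Type*} [NormedAddCommGroup W] [NormedSpace ℝ W]

lemma integrable_smul_sub_of_decay [Nontrivial V] {K : V → W} {m : ℕ} {C : ℝ} (hK : Continuous K)
    (hb : ∀ z, ‖K z‖ ≤ C / (1 + ‖z‖ ^ m)) {f : V → ℝ} (hf : Continuous f)
    (hfi : Integrable (fun y => ‖f y‖ / (1 + ‖y‖ ^ m)) μ) (x : V) :
    Integrable (fun y => f y • K (x - y)) μ :=
  (integrable_and_continuous_integral_of_decay (K := fun _ => K)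
    (fun _ _ _ => (hK.comp continuous_snd).continuousAt) (fun _ z _ => hb z) hf hfi
    (lsmul ℝ ℝ).flip).1 0 x

theorem hasFDerivAt_integral_smul_sub [Nontrivial V] {K : V → W} {K' : V → V →L[ℝ] W} {m : ℕ}
    {C : ℝ} (hK : ∀ z, HasFDerivAt K (K' z) z) (hK' : Continuous K')
    (hb : ∀ z, ‖K z‖ ≤ C / (1 + ‖z‖ ^ m)) (hb' : ∀ z, ‖K' z‖ ≤ C / (1 + ‖z‖ ^ m))
    {f : V → ℝ} (hf : Continuous f) (hfi : Integrable (fun y => ‖f y‖ / (1 + ‖y‖ ^ m)) μ) (x : V) :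
    HasFDerivAt (fun x => ∫ y, f y • K (x - y) ∂μ) (∫ y, f y • K' (x - y) ∂μ) x := by
  have hKc : Continuous K := continuous_iff_continuousAt.2 fun z => (hK z).continuousAt
  have hC : 0 ≤ C := by
    have := (norm_nonneg _).trans (hb 0)
    by_contra hneg
    exact absurd this (not_le.2 (div_neg_of_neg_of_pos (not_le.1 hneg) (by positivity)))
  refine hasFDerivAt_integral_of_dominated_of_fderiv_le (ball_mem_nhds x one_pos)
    (F := fun x y => f y • K (x - y)) (F' := fun x y => f y • K' (x - y))
    (bound := fun y => C * (1 + (2 * (1 + (‖x‖ + 1))) ^ m) * (‖f y‖ / (1 + ‖y‖ ^ m)))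
    (.of_forall fun x => (integrable_smul_sub_of_decay hKc hb hf hfi x).1)
    (integrable_smul_sub_of_decay hKc hb hf hfi x)
    (integrable_smul_sub_of_decay hK' hb' hf hfi x).1
    (.of_forall fun y z hz => ?_) (hfi.const_mul _) (.of_forall fun y z _ => ?_)
  · have hz' : ‖z‖ ≤ ‖x‖ + 1 := by
      have h1 := mem_ball_iff_norm.1 hz
      have h2 := norm_sub_norm_le z x
      linarith
    calc ‖f y • K' (z - y)‖ = ‖f y‖ * ‖K' (z - y)‖ := norm_smul _ _
      _ ≤ ‖f y‖ * (C / (1 + ‖z - y‖ ^ m)) := by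
        gcongr
        exact hb' _
      _ = C * (‖f y‖ / (1 + ‖z - y‖ ^ m)) := by ring
      _ ≤ C * ((1 + (2 * (1 + (‖x‖ + 1))) ^ m) * (‖f y‖ / (1 + ‖y‖ ^ m))) := by
        gcongr
        exact div_one_add_norm_sub_pow_le m (norm_nonneg _) hz' y
      _ = _ := by ring
  · have h := (hK (z - y)).comp z ((hasFDerivAt_id z).sub_const y)
    exact HasFDerivAt.const_smul (by simpa [Function.comp_def] using h) (f y)

/-- Integration by parts without boundary terms, since the product and both differentiated products
are integrable. The sign from differentiating `K (x - y)` in `y` cancels the sign of the integration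
by parts. -/
theorem integral_smul_fderiv_sub_eq [Nontrivial V] [CompleteSpace W] {K : V → W}
    {K' : V → V →L[ℝ] W} {m : ℕ}
    {C : ℝ} (hK : ∀ z, HasFDerivAt K (K' z) z) (hK' : Continuous K')
    (hb : ∀ z, ‖K z‖ ≤ C / (1 + ‖z‖ ^ m)) (hb' : ∀ z, ‖K' z‖ ≤ C / (1 + ‖z‖ ^ m))
    {f : V → ℝ} (hf : ContDiff ℝ 1 f) (hfi : Integrable (fun y => ‖f y‖ / (1 + ‖y‖ ^ m)) μ)
    (hfi' : Integrable (fun y => ‖fderiv ℝ f y‖ / (1 + ‖y‖ ^ m)) μ) (x : V) :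
    ∫ y, f y • K' (x - y) ∂μ = ∫ y, (fderiv ℝ f y).smulRight (K (x - y)) ∂μ := by
  have hKc : Continuous K := continuous_iff_continuousAt.2 fun z => (hK z).continuousAt
  have hI := integrable_smul_sub_of_decay hKc hb hf.continuous hfi x
  have hI1 := integrable_smul_sub_of_decay hK' hb' hf.continuous hfi x
  have hI2 : Integrable (fun y => (fderiv ℝ f y).smulRight (K (x - y))) μ :=
    (integrable_and_continuous_integral_of_decay (K := fun _ => K)
      (fun _ _ _ => (hKc.comp continuous_snd).continuousAt) (fun _ z _ => hb z)
      (hf.continuous_fderiv one_ne_zero) hfi' (smulRightL ℝ V W).flip).1 0 x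
  have hg : ∀ y, HasFDerivAt (fun y => K (x - y)) (-K' (x - y)) y := fun y => by
    simpa [Function.comp_def] using (hK (x - y)).comp y ((hasFDerivAt_id y).const_sub x)
  ext v
  rw [ContinuousLinearMap.integral_apply hI1, ContinuousLinearMap.integral_apply hI2]
  have key := integral_bilinear_fderiv_right_eq_neg_left_of_integrable (μ := μ) (f := f)
    (g := fun y => K (x - y)) (v := v) (B := lsmul ℝ ℝ) (hI2.apply_continuousLinearMap v)
    ?_ hI (fun y _ => hf.differentiable one_ne_zero y) (fun y _ => (hg y).differentiableAt)
  · simp only [(hg _).fderiv, lsmul_apply, neg_apply, smul_neg, integral_neg, neg_inj] at key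
    simpa using key
  · simp only [(hg _).fderiv]
    simpa using (hI1.apply_continuousLinearMap v).neg

end PotentialDerivative

/-! ### The regularised kernel, its gradient and its Hessian. -/

noncomputable section RegularisedKernels

open Filter Set Metric Module ContinuousLinearMap
open scoped Topology

set_option maxSynthPendingDepth 3

variable {V : Type*} [NormedAddCommGroup V]

/-- The regularised norm `√(ε² + ‖z‖²)`. -/
def regNorm (ε : ℝ) (z : V) : ℝ := √(ε ^ 2 + ‖z‖ ^ 2)

/-- The regularisation of `1 / ‖z‖ ^ m`. -/
def regKernel (m : ℕ) (ε : ℝ) (z : V) : ℝ := (regNorm ε z ^ m)⁻¹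

lemma regNorm_sq (ε : ℝ) (z : V) : regNorm ε z ^ 2 = ε ^ 2 + ‖z‖ ^ 2 :=
  Real.sq_sqrt (by positivity)

lemma regNorm_nonneg (ε : ℝ) (z : V) : 0 ≤ regNorm ε z := Real.sqrt_nonneg _

lemma regNorm_zero (z : V) : regNorm 0 z = ‖z‖ := by simp [regNorm]

lemma norm_le_regNorm (ε : ℝ) (z : V) : ‖z‖ ≤ regNorm ε z :=
  Real.le_sqrt_of_sq_le (by nlinarith [sq_nonneg ε])

lemma abs_le_regNorm (ε : ℝ) (z : V) : |ε| ≤ regNorm ε z :=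
  Real.le_sqrt_of_sq_le (by rw [sq_abs]; nlinarith [sq_nonneg ‖z‖])

lemma regNorm_pos_of_parameter {ε : ℝ} (hε : ε ≠ 0) (z : V) : 0 < regNorm ε z :=
  (abs_pos.2 hε).trans_le (abs_le_regNorm ε z)

lemma regNorm_pos_of_point (ε : ℝ) {z : V} (hz : z ≠ 0) : 0 < regNorm ε z :=
  (norm_pos_iff.2 hz).trans_le (norm_le_regNorm ε z)

lemma regKernel_nonneg (m : ℕ) (ε : ℝ) (z : V) : 0 ≤ regKernel m ε z :=
  inv_nonneg.2 (pow_nonneg (regNorm_nonneg ε z) m)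

lemma continuous_regNorm : Continuous (fun p : ℝ × V => regNorm p.1 p.2) := by
  unfold regNorm
  fun_prop

lemma continuousAt_regKernel (m : ℕ) {ε : ℝ} {z : V} (h : regNorm ε z ≠ 0) :
    ContinuousAt (fun p : ℝ × V => regKernel m p.1 p.2) (ε, z) :=
  (continuous_regNorm.continuousAt.pow m).inv₀ (pow_ne_zero m h)

lemma continuous_regKernel (m : ℕ) {ε : ℝ} (hε : ε ≠ 0) : Continuous (regKernel (V := V) m ε) :=
  continuous_iff_continuousAt.2 fun z =>
    (continuousAt_regKernel m (regNorm_pos_of_parameter hε z).ne').comp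
      (f := fun z => (ε, z)) (by fun_prop)

lemma norm_regKernel_le_div_norm_pow (m : ℕ) (ε : ℝ) {z : V} (hz : z ≠ 0) :
    ‖regKernel m ε z‖ ≤ 1 / ‖z‖ ^ m := by
  have hz' : 0 < ‖z‖ := norm_pos_iff.2 hz
  rw [Real.norm_of_nonneg (regKernel_nonneg m ε z), one_div]
  exact inv_anti₀ (by positivity) (pow_le_pow_left₀ hz'.le (norm_le_regNorm ε z) m)

lemma norm_mul_regKernel_succ_le (m : ℕ) (ε : ℝ) (z : V) :
    ‖z‖ * regKernel (m + 1) ε z ≤ regKernel m ε z := by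
  rcases (regNorm_nonneg ε z).eq_or_lt with h | h
  · have : ‖z‖ = 0 := le_antisymm ((norm_le_regNorm ε z).trans h.symm.le) (norm_nonneg z)
    rw [this, zero_mul]
    exact regKernel_nonneg m ε z
  · calc ‖z‖ * regKernel (m + 1) ε z ≤ regNorm ε z * regKernel (m + 1) ε z :=
        mul_le_mul_of_nonneg_right (norm_le_regNorm ε z) (regKernel_nonneg _ _ _)
      _ = regKernel m ε z := by
        unfold regKernel
        field_simp
        ring

/-- For `ε ≠ 0` the regularised kernel has no singularity. -/
lemma regKernel_le_div_one_add_norm_pow (k j : ℕ) {ε : ℝ} (hε : ε ≠ 0) (z : V) :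
    regKernel (k + j) ε z ≤ ((|ε| ^ j)⁻¹ * (1 + (|ε| ^ k)⁻¹)) / (1 + ‖z‖ ^ k) := by
  have hN := regNorm_pos_of_parameter hε z
  have hε' : 0 < |ε| := abs_pos.2 hε
  have h1 : ‖z‖ ^ k ≤ regNorm ε z ^ k := pow_le_pow_left₀ (norm_nonneg z) (norm_le_regNorm ε z) k
  have h2 : |ε| ^ k ≤ regNorm ε z ^ k := pow_le_pow_left₀ hε'.le (abs_le_regNorm ε z) k
  have h3 : (regNorm ε z ^ j)⁻¹ ≤ (|ε| ^ j)⁻¹ :=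
    inv_anti₀ (by positivity) (pow_le_pow_left₀ hε'.le (abs_le_regNorm ε z) j)
  have h4 : (regNorm ε z ^ k)⁻¹ ≤ (1 + (|ε| ^ k)⁻¹) / (1 + ‖z‖ ^ k) := by
    rw [inv_eq_one_div, div_le_div_iff₀ (by positivity) (by positivity)]
    have : 1 ≤ (|ε| ^ k)⁻¹ * regNorm ε z ^ k := by
      rw [inv_mul_eq_div, one_le_div (by positivity)]
      exact h2
    linarith
  calc regKernel (k + j) ε z = (regNorm ε z ^ j)⁻¹ * (regNorm ε z ^ k)⁻¹ := by
        rw [regKernel, pow_add, mul_inv, mul_comm]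
    _ ≤ (|ε| ^ j)⁻¹ * ((1 + (|ε| ^ k)⁻¹) / (1 + ‖z‖ ^ k)) := by gcongr
    _ = _ := by ring

/-- The `j` surplus powers are bounded by powers of `|ε|`, so the decay can be matched to a
prescribed weight. The constant may blow up as `ε → 0`; it is used only at fixed `ε`. -/
lemma exists_regKernel_le (k j : ℕ) {ε : ℝ} (hε : ε ≠ 0) {a : ℝ} (ha : 0 ≤ a) : ∃ C, ∀ z : V,
    a * regKernel (k + j) ε z ≤ C / (1 + ‖z‖ ^ k) :=
  ⟨a * ((|ε| ^ j)⁻¹ * (1 + (|ε| ^ k)⁻¹)), fun z => by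
    rw [mul_div_assoc]
    exact mul_le_mul_of_nonneg_left (regKernel_le_div_one_add_norm_pow k j hε z) ha⟩

variable [InnerProductSpace ℝ V]

/-- The real inner product as a linear map from a space to its dual. -/
def innerDual : V →L[ℝ] V →L[ℝ] ℝ where
  toFun v := innerSL ℝ v
  map_add' := by simp
  map_smul' := by simp
  cont := (innerSL ℝ (E := V)).cont

@[simp] lemma innerDual_apply (v w : V) : innerDual v w = inner ℝ v w := rfl

lemma norm_innerDual_apply (v : V) : ‖innerDual v‖ = ‖v‖ := innerSL_apply_norm ℝ v

lemma norm_innerDual_le : ‖(innerDual : V →L[ℝ] V →L[ℝ] ℝ)‖ ≤ 1 :=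
  opNorm_le_bound _ zero_le_one fun v => by rw [norm_innerDual_apply, one_mul]

/-- The derivative of `regKernel m ε`. -/
def regGrad (m : ℕ) (ε : ℝ) (z : V) : V →L[ℝ] ℝ := (-(m : ℝ) * regKernel (m + 2) ε z) • innerDual z

/-- The second derivative of `regKernel m ε`. -/
def regHess (m : ℕ) (ε : ℝ) (z : V) : V →L[ℝ] V →L[ℝ] ℝ :=
  (-(m : ℝ)) • (regKernel (m + 2) ε z • innerDual + (regGrad (m + 2) ε z).smulRight (innerDual z))

lemma continuousAt_regGrad (m : ℕ) {ε : ℝ} {z : V} (h : regNorm ε z ≠ 0) :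
    ContinuousAt (fun p : ℝ × V => regGrad m p.1 p.2) (ε, z) :=
  (continuousAt_const.mul (continuousAt_regKernel (m + 2) h)).smul (by fun_prop)

lemma continuous_regGrad (m : ℕ) {ε : ℝ} (hε : ε ≠ 0) : Continuous (regGrad (V := V) m ε) :=
  continuous_iff_continuousAt.2 fun z =>
    (continuousAt_regGrad m (regNorm_pos_of_parameter hε z).ne').comp
      (f := fun z => (ε, z)) (by fun_prop)

lemma continuous_regHess (m : ℕ) {ε : ℝ} (hε : ε ≠ 0) : Continuous (regHess (V := V) m ε) := by
  have h1 := continuous_regKernel (V := V) (m + 2) hε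
  have h2 := continuous_regGrad (V := V) (m + 2) hε
  have h3 : Continuous (fun z : V => smulRightL ℝ V (V →L[ℝ] ℝ) (regGrad (m + 2) ε z)
    (innerDual z)) := by fun_prop
  exact ((h1.smul continuous_const).add h3).const_smul (-(m : ℝ))

lemma hasFDerivAt_regKernel (m : ℕ) {ε : ℝ} {z : V} (h : regNorm ε z ≠ 0) :
    HasFDerivAt (regKernel m ε) (regGrad m ε z) z := by
  have h0 : ε ^ 2 + ‖z‖ ^ 2 ≠ 0 := by
    rw [← regNorm_sq]
    exact pow_ne_zero 2 h
  have h1 : HasFDerivAt (regNorm ε) ((regNorm ε z)⁻¹ • innerDual z) z := by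
    have h2 := ((hasStrictFDerivAt_norm_sq z).hasFDerivAt.const_add (ε ^ 2)).sqrt h0
    refine h2.congr_fderiv ?_
    ext v
    simp only [regNorm, smul_apply, smul_eq_mul, innerDual_apply, innerSL_apply_apply,
      nsmul_eq_mul, Nat.cast_ofNat]
    field_simp
  have h3 := (hasDerivAt_inv (pow_ne_zero m h)).comp_hasFDerivAt z (h1.pow m)
  refine h3.congr_fderiv ?_
  ext v
  simp only [regGrad, regKernel, smul_apply, smul_eq_mul, innerDual_apply, nsmul_eq_mul]
  rcases m with _ | m
  · simp
  · simp only [Nat.add_sub_cancel]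
    field_simp
    ring

lemma hasFDerivAt_regGrad (m : ℕ) {ε : ℝ} {z : V} (h : regNorm ε z ≠ 0) :
    HasFDerivAt (regGrad m ε) (regHess m ε z) z := by
  have h1 := ((hasFDerivAt_regKernel (m + 2) h).smul
    (innerDual (V := V)).hasFDerivAt).const_smul (-(m : ℝ))
  refine (h1.congr_of_eventuallyEq (.of_forall fun w => ?_)).congr_fderiv rfl
  simp only [regGrad, mul_smul, Pi.smul_apply, Pi.smul_apply']

lemma norm_regGrad_le (m : ℕ) (ε : ℝ) (z : V) :
    ‖regGrad m ε z‖ ≤ m * regKernel (m + 1) ε z := by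
  rw [regGrad, norm_smul, norm_mul, norm_neg, Real.norm_natCast, norm_innerDual_apply,
    Real.norm_of_nonneg (regKernel_nonneg _ _ _), mul_assoc, mul_comm _ ‖z‖]
  exact mul_le_mul_of_nonneg_left (norm_mul_regKernel_succ_le _ _ _) m.cast_nonneg

lemma norm_regGrad_le_div_norm_pow (m : ℕ) (ε : ℝ) {z : V} (hz : z ≠ 0) :
    ‖regGrad m ε z‖ ≤ m / ‖z‖ ^ (m + 1) := by
  refine (norm_regGrad_le m ε z).trans ?_
  rw [← mul_one_div]
  refine mul_le_mul_of_nonneg_left ?_ m.cast_nonneg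
  exact (le_abs_self _).trans (norm_regKernel_le_div_norm_pow _ _ hz)

lemma norm_regHess_le (m : ℕ) (ε : ℝ) (z : V) :
    ‖regHess m ε z‖ ≤ m * (m + 3) * regKernel (m + 2) ε z := by
  have h1 : ‖regKernel (m + 2) ε z • (innerDual : V →L[ℝ] V →L[ℝ] ℝ)‖ ≤ regKernel (m + 2) ε z := by
    rw [norm_smul, Real.norm_of_nonneg (regKernel_nonneg _ _ _)]
    exact mul_le_of_le_one_right (regKernel_nonneg _ _ _) norm_innerDual_le
  have h2 : ‖(regGrad (m + 2) ε z).smulRight (innerDual z)‖ ≤ (m + 2) * regKernel (m + 2) ε z := by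
    rw [norm_smulRight_apply, norm_innerDual_apply]
    calc ‖regGrad (m + 2) ε z‖ * ‖z‖ ≤ ((m + 2 : ℕ) * regKernel (m + 2 + 1) ε z) * ‖z‖ := by
          gcongr
          exact norm_regGrad_le _ _ _
      _ = (m + 2) * (‖z‖ * regKernel (m + 2 + 1) ε z) := by push_cast; ring
      _ ≤ _ := by
        gcongr
        exact norm_mul_regKernel_succ_le _ _ _
  rw [regHess, norm_smul, norm_neg, Real.norm_natCast, mul_assoc]
  refine mul_le_mul_of_nonneg_left ?_ m.cast_nonneg
  calc _ ≤ _ := norm_add_le _ _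
    _ ≤ regKernel (m + 2) ε z + (m + 2) * regKernel (m + 2) ε z := add_le_add h1 h2
    _ = _ := by ring

/-- With `N = regNorm ε z`, the trace is `m (m + 2) (‖z‖² - N²) / N ^ (m + 4)`, and `‖z‖² - N² =
-ε²`. At `ε = 0` this is the harmonicity of `1 / ‖z‖ ^ m` in dimension `m + 2`. -/
lemma sum_regHess_apply {ι : Type*} [Fintype ι] (b : OrthonormalBasis ι ℝ V) {m : ℕ}
    (hm : Fintype.card ι = m + 2) {ε : ℝ} {z : V} (h : regNorm ε z ≠ 0) :
    ∑ i, regHess m ε z (b i) (b i) = -(m * (m + 2)) * (ε ^ 2 * regKernel (m + 4) ε z) := by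
  have h1 : ∑ i, inner ℝ z (b i) ^ 2 = ‖z‖ ^ 2 := by
    rw [← b.sum_sq_norm_inner_left z]
    simp
  have h2 : ∀ i, regHess m ε z (b i) (b i) = -m * regKernel (m + 2) ε z +
      (m * (m + 2) * regKernel (m + 4) ε z) * inner ℝ z (b i) ^ 2 := by
    intro i
    simp only [regHess, regGrad, smul_apply, add_apply, smulRight_apply, innerDual_apply,
      smul_eq_mul, real_inner_self_eq_norm_sq, b.norm_eq_one]
    push_cast
    ring
  simp only [h2, Finset.sum_add_distrib, ← Finset.mul_sum, h1, Finset.sum_const, Finset.card_univ,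
    hm, nsmul_eq_mul]
  have h3 : ‖z‖ ^ 2 = regNorm ε z ^ 2 - ε ^ 2 := by rw [regNorm_sq]; ring
  have h4 : regKernel (m + 2) ε z = regNorm ε z ^ 2 * regKernel (m + 4) ε z := by
    unfold regKernel
    field_simp
    ring
  rw [h3, h4]
  push_cast
  ring

end RegularisedKernels

/-! ### First and second derivatives of the potential of `1 / ‖x‖ ^ m`. -/

section RieszPotential

open Filter Set Metric Module ContinuousLinearMap
open scoped Topology

set_option maxSynthPendingDepth 3

lemma integrable_norm_div_one_add_norm_pow_succ {V W : Type*} [NormedAddCommGroup V]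
    [MeasurableSpace V] [OpensMeasurableSpace V] {μ : Measure V} [NormedAddCommGroup W] {g : V → W}
    (hg : Continuous g) {m : ℕ} (h : Integrable (fun y => ‖g y‖ / (1 + ‖y‖ ^ m)) μ) :
    Integrable (fun y => ‖g y‖ / (1 + ‖y‖ ^ (m + 1))) μ := by
  refine Integrable.mono' (h.const_mul 2) (Continuous.aestronglyMeasurable ?_)
    (.of_forall fun y => ?_)
  · exact hg.norm.div (by fun_prop) fun y => by positivity
  · rw [Real.norm_of_nonneg (by positivity), mul_div_assoc',
      div_le_div_iff₀ (by positivity) (by positivity)]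
    have h1 : 1 + ‖y‖ ^ m ≤ 2 * (1 + ‖y‖ ^ (m + 1)) := by
      have h0 := norm_nonneg y
      have h3 := pow_nonneg h0 (m + 1)
      rcases le_total ‖y‖ 1 with h2 | h2
      · have := pow_le_one₀ (n := m) h0 h2
        linarith
      · have := pow_le_pow_right₀ h2 (Nat.le_succ m)
        simp only [Nat.succ_eq_add_one] at this
        linarith
    nlinarith [mul_le_mul_of_nonneg_left h1 (norm_nonneg (g y))]

/-- The Hessian decays one order faster, but the common weight `m + 1` is the one available for both
`f` and its derivative. -/
lemma exists_regGrad_regHess_le {V : Type*} [NormedAddCommGroup V]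
    [InnerProductSpace ℝ V] (m : ℕ) {ε : ℝ} (hε : ε ≠ 0) : ∃ C : ℝ, ∀ z : V,
    ‖regGrad m ε z‖ ≤ C / (1 + ‖z‖ ^ (m + 1)) ∧ ‖regHess m ε z‖ ≤ C / (1 + ‖z‖ ^ (m + 1)) := by
  obtain ⟨C₁, h1⟩ := exists_regKernel_le (V := V) (m + 1) 0 hε m.cast_nonneg
  obtain ⟨C₂, h2⟩ := exists_regKernel_le (V := V) (m + 1) 1 hε
    (a := (m : ℝ) * (m + 3)) (by positivity)
  refine ⟨max C₁ C₂, fun z => ⟨?_, ?_⟩⟩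
  · exact (norm_regGrad_le m ε z).trans
      ((h1 z).trans (div_le_div_of_nonneg_right (le_max_left _ _) (by positivity)))
  · exact (norm_regHess_le m ε z).trans
      ((h2 z).trans (div_le_div_of_nonneg_right (le_max_right _ _) (by positivity)))

variable {V : Type*} [NormedAddCommGroup V] [InnerProductSpace ℝ V] [FiniteDimensional ℝ V]
  [MeasurableSpace V] [BorelSpace V] {μ : Measure V} [μ.IsAddHaarMeasure]

variable {m : ℕ} {f : V → ℝ}

lemma integrable_and_continuous_regKernel [Nontrivial V] (hm : m < finrank ℝ V) (hf : Continuous f)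
    (hfi : Integrable (fun y => ‖f y‖ / (1 + ‖y‖ ^ m)) μ) :
    (∀ ε x, Integrable (fun y => f y • regKernel m ε (x - y)) μ) ∧
    Continuous (fun p : ℝ × V => ∫ y, f y • regKernel m p.1 (p.2 - y) ∂μ) :=
  integrable_and_continuous_integral_of_singular hm
    (fun ε _ hz => continuousAt_regKernel m (regNorm_pos_of_point ε hz).ne')
    (fun ε _ hz => norm_regKernel_le_div_norm_pow m ε hz) hf hfi (lsmul ℝ ℝ).flip

lemma integrable_and_continuous_regGrad [Nontrivial V] {W₁ W₂ : Type*} [NormedAddCommGroup W₁]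
    [NormedSpace ℝ W₁] [NormedAddCommGroup W₂] [NormedSpace ℝ W₂] {g : V → W₁}
    (hm : m + 1 < finrank ℝ V) (hg : Continuous g)
    (hgi : Integrable (fun y => ‖g y‖ / (1 + ‖y‖ ^ (m + 1))) μ)
    (L : (V →L[ℝ] ℝ) →L[ℝ] W₁ →L[ℝ] W₂) :
    (∀ ε x, Integrable (fun y => L (regGrad m ε (x - y)) (g y)) μ) ∧
    Continuous (fun p : ℝ × V => ∫ y, L (regGrad m p.1 (p.2 - y)) (g y) ∂μ) :=
  integrable_and_continuous_integral_of_singular hm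
    (fun ε _ hz => continuousAt_regGrad m (regNorm_pos_of_point ε hz).ne')
    (fun ε _ hz => norm_regGrad_le_div_norm_pow m ε hz) hg hgi L

lemma hasFDerivAt_regKernel_potential [Nontrivial V] (hm : m + 1 < finrank ℝ V) (hf : Continuous f)
    (hfi : Integrable (fun y => ‖f y‖ / (1 + ‖y‖ ^ m)) μ) (x : V) :
    HasFDerivAt (fun x => ∫ y, f y • regKernel m 0 (x - y) ∂μ)
      (∫ y, f y • regGrad m 0 (x - y) ∂μ) x := by
  refine hasFDerivAt_zero_of_continuous_parameter
    (F := fun p : ℝ × V => ∫ y, f y • regKernel m p.1 (p.2 - y) ∂μ)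
    (F' := fun p : ℝ × V => ∫ y, f y • regGrad m p.1 (p.2 - y) ∂μ)
    (integrable_and_continuous_regKernel (by omega) hf hfi).2
    (integrable_and_continuous_regGrad hm hf (integrable_norm_div_one_add_norm_pow_succ hf hfi)
      (lsmul ℝ ℝ).flip).2 (fun ε x hε => ?_) x
  obtain ⟨C₁, h1⟩ := exists_regKernel_le (V := V) m 0 hε zero_le_one
  obtain ⟨C₂, h2⟩ := exists_regKernel_le (V := V) m 1 hε m.cast_nonneg
  refine hasFDerivAt_integral_smul_sub (m := m) (C := max C₁ C₂)
    (fun z => hasFDerivAt_regKernel m (regNorm_pos_of_parameter hε z).ne')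
    (continuous_regGrad m hε) (fun z => ?_) (fun z => ?_) hf hfi x
  · rw [Real.norm_of_nonneg (regKernel_nonneg _ _ _), ← one_mul (regKernel m ε z)]
    exact (h1 z).trans (div_le_div_of_nonneg_right (le_max_left _ _) (by positivity))
  · exact (norm_regGrad_le m ε z).trans
      ((h2 z).trans (div_le_div_of_nonneg_right (le_max_right _ _) (by positivity)))

lemma integral_smul_regHess_eq [Nontrivial V] (hf : ContDiff ℝ 1 f)
    (hfi : Integrable (fun y => ‖f y‖ / (1 + ‖y‖ ^ (m + 1))) μ)
    (hfi' : Integrable (fun y => ‖fderiv ℝ f y‖ / (1 + ‖y‖ ^ (m + 1))) μ) {ε : ℝ} (hε : ε ≠ 0)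
    (x : V) : ∫ y, f y • regHess m ε (x - y) ∂μ =
      ∫ y, (fderiv ℝ f y).smulRight (regGrad m ε (x - y)) ∂μ := by
  obtain ⟨C, hC⟩ := exists_regGrad_regHess_le (V := V) m hε
  exact integral_smul_fderiv_sub_eq
    (fun z => hasFDerivAt_regGrad m (regNorm_pos_of_parameter hε z).ne')
    (continuous_regHess m hε) (fun z => (hC z).1) (fun z => (hC z).2) hf hfi hfi' x

lemma integrable_and_continuous_fderiv_smulRight_regGrad [Nontrivial V]
    (hm : m + 1 < finrank ℝ V) (hf : ContDiff ℝ 1 f)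
    (hfi' : Integrable (fun y => ‖fderiv ℝ f y‖ / (1 + ‖y‖ ^ (m + 1))) μ) :
    (∀ ε x, Integrable (fun y => (fderiv ℝ f y).smulRight (regGrad m ε (x - y))) μ) ∧
    Continuous (fun p : ℝ × V => ∫ y, (fderiv ℝ f y).smulRight (regGrad m p.1 (p.2 - y)) ∂μ) :=
  integrable_and_continuous_regGrad hm (hf.continuous_fderiv one_ne_zero) hfi'
    (smulRightL ℝ V (V →L[ℝ] ℝ)).flip

/-- In dimension `m + 2` the Hessian of the kernel is not absolutely integrable at the origin, so
the integration by parts must precede the limit `ε → 0`. -/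
lemma hasFDerivAt_regGrad_potential [Nontrivial V] (hm : m + 1 < finrank ℝ V) (hf : ContDiff ℝ 1 f)
    (hfi : Integrable (fun y => ‖f y‖ / (1 + ‖y‖ ^ (m + 1))) μ)
    (hfi' : Integrable (fun y => ‖fderiv ℝ f y‖ / (1 + ‖y‖ ^ (m + 1))) μ) (x : V) :
    HasFDerivAt (fun x => ∫ y, f y • regGrad m 0 (x - y) ∂μ)
      (∫ y, (fderiv ℝ f y).smulRight (regGrad m 0 (x - y)) ∂μ) x := by
  refine hasFDerivAt_zero_of_continuous_parameter
    (F := fun p : ℝ × V => ∫ y, f y • regGrad m p.1 (p.2 - y) ∂μ)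
    (F' := fun p : ℝ × V => ∫ y, (fderiv ℝ f y).smulRight (regGrad m p.1 (p.2 - y)) ∂μ)
    (integrable_and_continuous_regGrad hm hf.continuous hfi (lsmul ℝ ℝ).flip).2
    (integrable_and_continuous_fderiv_smulRight_regGrad hm hf hfi').2 (fun ε x hε => ?_) x
  obtain ⟨C, hC⟩ := exists_regGrad_regHess_le (V := V) m hε
  refine (hasFDerivAt_integral_smul_sub
    (fun z => hasFDerivAt_regGrad m (regNorm_pos_of_parameter hε z).ne')
    (continuous_regHess m hε) (fun z => (hC z).1) (fun z => (hC z).2) hf.continuous hfi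
    x).congr_fderiv (integral_smul_regHess_eq hf hfi hfi' hε x)

end RieszPotential

/-! ### The trace of the Hessian as an approximate identity. -/

section ApproximateIdentity

open Filter Set Metric Module
open scoped Topology

/-- With `ε = c⁻¹`, this is the mollifier form `c ^ n * φ (c • z)`. -/
lemma regKernel_inv_eq {V : Type*} [NormedAddCommGroup V] [NormedSpace ℝ V] (n : ℕ) {c : ℝ}
    (hc : 0 < c) (z : V) :
    c⁻¹ ^ 2 * regKernel (n + 2) c⁻¹ z = c ^ n * regKernel (n + 2) 1 (c • z) := by
  have h : regNorm 1 (c • z) = c * regNorm c⁻¹ z := by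
    rw [regNorm, regNorm, norm_smul, Real.norm_of_nonneg hc.le]
    nth_rw 2 [← Real.sqrt_sq hc.le]
    rw [← Real.sqrt_mul (by positivity)]
    congr 1
    field_simp
  have hN := regNorm_pos_of_parameter (inv_pos.2 hc).ne' z
  rw [regKernel, regKernel, h, mul_pow]
  field_simp
  ring

/-- An explicit primitive is `n⁻¹ (r / √(1 + r²)) ^ n`, which vanishes at `0` and tends to `n⁻¹`. -/
lemma integral_Ioi_pow_mul_inv_sqrt_pow {n : ℕ} (hn : n ≠ 0) :
    ∫ r in Ioi (0 : ℝ), r ^ (n - 1) * (√(1 ^ 2 + r ^ 2) ^ (n + 2))⁻¹ = (n : ℝ)⁻¹ := by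
  have hs : ∀ r : ℝ, 0 < 1 ^ 2 + r ^ 2 := fun r => by positivity
  have hd : ∀ r : ℝ, HasDerivAt (fun r : ℝ => (n : ℝ)⁻¹ * (r / √(1 ^ 2 + r ^ 2)) ^ n)
      (r ^ (n - 1) * (√(1 ^ 2 + r ^ 2) ^ (n + 2))⁻¹) r := by
    intro r
    have hq := Real.sqrt_pos.2 (hs r)
    have hq2 := Real.sq_sqrt (hs r).le
    have h1 : HasDerivAt (fun r : ℝ => 1 ^ 2 + r ^ 2) (2 * r) r := by
      simpa using (hasDerivAt_pow 2 r).const_add (1 ^ 2 : ℝ)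
    have h2 := (((hasDerivAt_id r).div (h1.sqrt (hs r).ne') hq.ne').pow n).const_mul (n : ℝ)⁻¹
    refine h2.congr_deriv ?_
    obtain ⟨k, rfl⟩ := Nat.exists_eq_succ_of_ne_zero hn
    simp only [Nat.succ_eq_add_one, Nat.add_sub_cancel, id_eq, Pi.div_apply]
    generalize √(1 ^ 2 + r ^ 2) = q at *
    have hq3 : 1 * q - r * (2 * r / (2 * q)) = 1 / q := by
      field_simp
      linarith
    rw [hq3, div_pow]
    field_simp
    ring
  have ht : Tendsto (fun r : ℝ => (n : ℝ)⁻¹ * (r / √(1 ^ 2 + r ^ 2)) ^ n) atTop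
      (𝓝 ((n : ℝ)⁻¹)) := by
    have h1 : Tendsto (fun r : ℝ => √(1 / (1 + (r ^ 2)⁻¹))) atTop (𝓝 √(1 / (1 + 0))) :=
      ((tendsto_const_nhds.div (tendsto_const_nhds.add
        (tendsto_inv_atTop_zero.comp (tendsto_pow_atTop two_ne_zero))) (by norm_num))).sqrt
    have h2 : Tendsto (fun r : ℝ => r / √(1 ^ 2 + r ^ 2)) atTop (𝓝 1) := by
      have h3 : √(1 / (1 + 0) : ℝ) = 1 := by simp
      rw [h3] at h1
      refine h1.congr' ?_
      filter_upwards [eventually_gt_atTop 0] with r hr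
      rw [show (1 : ℝ) / (1 + (r ^ 2)⁻¹) = r ^ 2 / (1 ^ 2 + r ^ 2) by field_simp; ring,
        Real.sqrt_div (by positivity), Real.sqrt_sq hr.le]
    simpa using (h2.pow n).const_mul (n : ℝ)⁻¹
  rw [integral_Ioi_of_hasDerivAt_of_nonneg' (fun r _ => hd r)
    (fun r hr => by have := mem_Ioi.1 hr; positivity) ht]
  simp [hn]

variable {V : Type*} [NormedAddCommGroup V] [InnerProductSpace ℝ V] [FiniteDimensional ℝ V]
  [MeasurableSpace V] [BorelSpace V] {μ : Measure V} [μ.IsAddHaarMeasure]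

lemma integral_regKernel_one [Nontrivial V] :
    ∫ z, regKernel (finrank ℝ V + 2) 1 z ∂μ = μ.real (ball 0 1) := by
  have hn : finrank ℝ V ≠ 0 := finrank_pos.ne'
  have h := integral_fun_norm_addHaar μ
    (fun r : ℝ => (√(1 ^ 2 + r ^ 2) ^ (finrank ℝ V + 2))⁻¹)
  simp only [smul_eq_mul, integral_Ioi_pow_mul_inv_sqrt_pow hn, nsmul_eq_mul] at h
  simp only [regKernel, regNorm]
  rw [h]
  field_simp

/-- The kernels `ε² / (ε² + ‖z‖²) ^ ((n + 2) / 2)`, where `n` is the dimension, form an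
approximate identity, up to the factor `μ (ball 0 1)`. -/
theorem tendsto_integral_regKernel [Nontrivial V] {f : V → ℝ} (hf : Continuous f)
    (hfi : Integrable (fun y => ‖f y‖ / (1 + ‖y‖ ^ finrank ℝ V)) μ) (x : V) :
    Tendsto (fun c : ℝ => ∫ y, f y * (c⁻¹ ^ 2 * regKernel (finrank ℝ V + 2) c⁻¹ (x - y)) ∂μ) atTop
      (𝓝 (μ.real (ball (0 : V) 1) * f x)) := by
  set n := finrank ℝ V with hn
  set v := μ.real (ball (0 : V) 1) with hv
  have hv0 : 0 < v := ENNReal.toReal_pos (measure_ball_pos μ _ one_pos).ne' measure_ball_lt_top.ne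
  have hint : ∀ c : ℝ, 0 < c →
      Integrable (fun y => f y * (c⁻¹ ^ 2 * regKernel (n + 2) c⁻¹ (x - y))) μ := by
    intro c hc
    obtain ⟨C, hC⟩ := exists_regKernel_le (V := V) n 2 (inv_pos.2 hc).ne' (sq_nonneg c⁻¹)
    refine integrable_smul_sub_of_decay (m := n) (C := C)
      ((continuous_regKernel (n + 2) (inv_pos.2 hc).ne').const_mul (c⁻¹ ^ 2)) (fun z => ?_) hf hfi x
    rw [Real.norm_of_nonneg (mul_nonneg (sq_nonneg _) (regKernel_nonneg _ _ _))]
    exact hC z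
  -- Near `x`, the mollifier theorem is applied to `f` truncated to a ball, because `f` itself need
  -- not be integrable.
  have hnear : Tendsto (fun c : ℝ => ∫ y in closedBall x 1,
      f y * (c⁻¹ ^ 2 * regKernel (n + 2) c⁻¹ (x - y)) ∂μ) atTop (𝓝 (v * f x)) := by
    have h1 : Integrable ((closedBall x 1).indicator f) μ :=
      (integrable_indicator_iff measurableSet_closedBall).2
        (hf.continuousOn.integrableOn_compact (isCompact_closedBall x 1))
    have h2 : (closedBall x 1).indicator f =ᶠ[𝓝 x] f := by
      filter_upwards [closedBall_mem_nhds x one_pos] with y hy using indicator_of_mem hy f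
    have h3 := tendsto_integral_comp_smul_smul_of_integrable' (μ := μ)
      (φ := fun z => v⁻¹ * regKernel (n + 2) 1 z) (fun z => mul_nonneg (inv_nonneg.2 hv0.le)
        (regKernel_nonneg _ _ _))
      (by rw [integral_const_mul, integral_regKernel_one, inv_mul_cancel₀ hv0.ne']) ?_ h1
      (hf.continuousAt.congr h2.symm)
    · rw [h2.self_of_nhds] at h3
      refine (h3.const_mul v).congr' ?_
      filter_upwards [eventually_gt_atTop 0] with c hc
      rw [← integral_indicator measurableSet_closedBall, ← integral_const_mul]
      refine integral_congr_ae (.of_forall fun y => ?_)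
      by_cases hy : y ∈ closedBall x 1
      · simp only [indicator_of_mem hy, smul_eq_mul, regKernel_inv_eq n hc, ← hn]
        field_simp
      · simp only [indicator_of_notMem hy, smul_zero, mul_zero]
    · have h4 : Tendsto (fun z : V => v⁻¹ * (‖z‖ ^ 2)⁻¹) (Bornology.cobounded V) (𝓝 (v⁻¹ * 0)) :=
        (tendsto_inv_atTop_zero.comp ((tendsto_pow_atTop two_ne_zero).comp
          tendsto_norm_cobounded_atTop)).const_mul v⁻¹
      rw [mul_zero] at h4
      refine squeeze_zero' (.of_forall fun z => ?_) ?_ h4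
      · have := regKernel_nonneg (n + 2) 1 z
        positivity
      · filter_upwards [tendsto_norm_cobounded_atTop.eventually_gt_atTop 0] with z hz'
        have hz := norm_pos_iff.1 hz'
        have h5 : regKernel (n + 2) 1 z ≤ 1 / ‖z‖ ^ (n + 2) :=
          (le_abs_self _).trans (norm_regKernel_le_div_norm_pow (n + 2) 1 hz)
        calc ‖z‖ ^ n * (v⁻¹ * regKernel (n + 2) 1 z)
            ≤ ‖z‖ ^ n * (v⁻¹ * (1 / ‖z‖ ^ (n + 2))) := by gcongr
          _ = v⁻¹ * (‖z‖ ^ 2)⁻¹ := by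
            rw [pow_add]
            field_simp
  -- Away from `x` the kernel is at most `c⁻¹ ^ 2` times a constant times the weight, so the
  -- prefactor alone forces the limit `0`.
  have hfar : Tendsto (fun c : ℝ => ∫ y in (closedBall x 1)ᶜ,
      f y * (c⁻¹ ^ 2 * regKernel (n + 2) c⁻¹ (x - y)) ∂μ) atTop (𝓝 0) := by
    set B := 2 * (1 + (2 * (1 + ‖x‖)) ^ n) with hB
    have h1 : Tendsto (fun c : ℝ => c⁻¹ ^ 2 * ∫ y in (closedBall x 1)ᶜ,
        B * (‖f y‖ / (1 + ‖y‖ ^ n)) ∂μ) atTop (𝓝 (0 ^ 2 * ∫ y in (closedBall x 1)ᶜ,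
        B * (‖f y‖ / (1 + ‖y‖ ^ n)) ∂μ)) := (tendsto_inv_atTop_zero.pow 2).mul_const _
    rw [zero_pow two_ne_zero, zero_mul] at h1
    refine squeeze_zero_norm (fun c => ?_) h1
    rw [← integral_const_mul]
    refine norm_integral_le_of_norm_le ((hfi.const_mul _).const_mul _).integrableOn ?_
    filter_upwards [ae_restrict_mem measurableSet_closedBall.compl] with y hy
    have h2 : 1 < ‖x - y‖ := by
      rw [norm_sub_rev, ← mem_closedBall_iff_norm.not.trans not_le]
      exact hy
    have h3 : regKernel (n + 2) c⁻¹ (x - y) ≤ 1 / ‖x - y‖ ^ (n + 2) :=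
      (le_abs_self _).trans (norm_regKernel_le_div_norm_pow (n + 2) c⁻¹
        (norm_pos_iff.1 (one_pos.trans h2)))
    have h4 : 1 / ‖x - y‖ ^ (n + 2) ≤ 2 / (1 + ‖x - y‖ ^ n) := by
      rw [div_le_div_iff₀ (by positivity) (by positivity)]
      have h5 := pow_le_pow_right₀ h2.le (Nat.le_add_right n 2)
      have h6 := one_le_pow₀ h2.le (n := n + 2)
      linarith
    rw [norm_mul, Real.norm_of_nonneg (mul_nonneg (sq_nonneg _) (regKernel_nonneg _ _ _))]
    calc ‖f y‖ * (c⁻¹ ^ 2 * regKernel (n + 2) c⁻¹ (x - y))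
        ≤ ‖f y‖ * (c⁻¹ ^ 2 * (2 / (1 + ‖x - y‖ ^ n))) := by
          gcongr
          exact h3.trans h4
      _ = c⁻¹ ^ 2 * (2 * (‖f y‖ / (1 + ‖x - y‖ ^ n))) := by ring
      _ ≤ c⁻¹ ^ 2 * (2 * ((1 + (2 * (1 + ‖x‖)) ^ n) * (‖f y‖ / (1 + ‖y‖ ^ n)))) := by
          gcongr
          exact div_one_add_norm_sub_pow_le n (norm_nonneg _) le_rfl y
      _ = c⁻¹ ^ 2 * (B * (‖f y‖ / (1 + ‖y‖ ^ n))) := by rw [hB]; ring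
  have hsum := hnear.add hfar
  rw [add_zero] at hsum
  refine hsum.congr' ?_
  filter_upwards [eventually_gt_atTop 0] with c hc
  exact integral_add_compl measurableSet_closedBall (hint c hc)

end ApproximateIdentity

/-! ### The Laplacian of the potential and the main theorem. -/

section NewtonPotential

open Filter Set Metric Module
open scoped Topology

set_option maxSynthPendingDepth 3

/-- The trace of the second derivative of the potential of `1 / ‖x‖ ^ m` in dimension `m + 2`. -/
theorem sum_integral_fderiv_smulRight_regGrad {V : Type*} [NormedAddCommGroup V]
    [InnerProductSpace ℝ V] [FiniteDimensional ℝ V] [MeasurableSpace V] [BorelSpace V]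
    {μ : Measure V} [μ.IsAddHaarMeasure] {ι : Type*} [Fintype ι] (b : OrthonormalBasis ι ℝ V)
    {m : ℕ} (hm : finrank ℝ V = m + 2) {f : V → ℝ} (hf : ContDiff ℝ 1 f)
    (hfi : Integrable (fun y => ‖f y‖ / (1 + ‖y‖ ^ (m + 1))) μ)
    (hfi' : Integrable (fun y => ‖fderiv ℝ f y‖ / (1 + ‖y‖ ^ (m + 1))) μ) (x : V) :
    ∑ i, (∫ y, (fderiv ℝ f y).smulRight (regGrad m 0 (x - y)) ∂μ) (b i) (b i) =
      -(m * (m + 2)) * (μ.real (ball (0 : V) 1) * f x) := by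
  have : Nontrivial V := nontrivial_of_finrank_pos (R := ℝ) (by omega)
  have hU := (integrable_and_continuous_fderiv_smulRight_regGrad (m := m) (by omega) hf hfi').2
  have h1 : Tendsto (fun c : ℝ =>
      ∑ i, (∫ y, (fderiv ℝ f y).smulRight (regGrad m c⁻¹ (x - y)) ∂μ) (b i) (b i)) atTop
      (𝓝 (∑ i, (∫ y, (fderiv ℝ f y).smulRight (regGrad m 0 (x - y)) ∂μ) (b i) (b i))) := by
    have h2 : Continuous (fun ε : ℝ =>
        ∑ i, (∫ y, (fderiv ℝ f y).smulRight (regGrad m ε (x - y)) ∂μ) (b i) (b i)) := by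
      have h3 : Continuous (fun ε : ℝ => ∫ y, (fderiv ℝ f y).smulRight (regGrad m ε (x - y)) ∂μ) :=
        hU.comp (f := fun ε => (ε, x)) (by fun_prop)
      fun_prop
    exact (h2.tendsto 0).comp tendsto_inv_atTop_zero
  -- The weight exponent is raised once more, from `m + 1` to the dimension `m + 2`.
  have h2 := (tendsto_integral_regKernel hf.continuous
    (hm ▸ integrable_norm_div_one_add_norm_pow_succ hf.continuous hfi) x).const_mul
    (-((m : ℝ) * (m + 2)))
  -- The trace has two limits as `ε = c⁻¹ → 0`: by continuity its value at `ε = 0`, and, after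
  -- undoing the integration by parts, the mollifier limit.
  refine tendsto_nhds_unique h1 (h2.congr' ?_)
  filter_upwards [eventually_gt_atTop 0] with c hc
  have hε := (inv_pos.2 hc).ne'
  obtain ⟨C, hC⟩ := exists_regGrad_regHess_le (V := V) m hε
  have hI := integrable_smul_sub_of_decay (continuous_regHess m hε) (fun z => (hC z).2)
    hf.continuous hfi x
  rw [← integral_smul_regHess_eq hf hfi hfi' hε x]
  simp_rw [ContinuousLinearMap.integral_apply hI,
    ContinuousLinearMap.integral_apply (hI.apply_continuousLinearMap _)]
  rw [← integral_finsetSum _ fun i _ =>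
    (hI.apply_continuousLinearMap (b i)).apply_continuousLinearMap (b i), ← integral_const_mul]
  refine integral_congr_ae (.of_forall fun y => ?_)
  have hcard : Fintype.card ι = m + 2 := by rw [← finrank_eq_card_basis b.toBasis, hm]
  simp only [smul_apply, smul_eq_mul, ← Finset.mul_sum, hm]
  rw [sum_regHess_apply b hcard (regNorm_pos_of_parameter hε _).ne']
  ring

lemma fundamentalSolution_eq_mul_regKernel (m : ℕ) (z : EuclideanSpace ℝ (Fin (m + 2))) :
    fundamentalSolution (m + 2) z =
      -1 / (((m + 2 : ℕ) - 2 : ℝ) * sphereArea (m + 2)) * regKernel m 0 z := by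
  simp [fundamentalSolution, regKernel, regNorm_zero]

lemma partialDeriv_eq_of_hasFDerivAt {n : ℕ} {g : EuclideanSpace ℝ (Fin n) → ℝ}
    {g' : EuclideanSpace ℝ (Fin n) →L[ℝ] ℝ} {x : EuclideanSpace ℝ (Fin n)}
    (h : HasFDerivAt g g' x) (i : Fin n) : partialDeriv i g x = g' (EuclideanSpace.single i 1) :=
  (h.hasLineDerivAt _).lineDeriv

lemma contDiff_two_of_hasFDerivAt {V W : Type*} [NormedAddCommGroup V] [NormedSpace ℝ V]
    [NormedAddCommGroup W] [NormedSpace ℝ W] {u : V → W} {u' : V → V →L[ℝ] W}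
    {u'' : V → V →L[ℝ] V →L[ℝ] W} (h : ∀ x, HasFDerivAt u (u' x) x)
    (h' : ∀ x, HasFDerivAt u' (u'' x) x) (h'' : Continuous u'') : ContDiff ℝ 2 u := by
  have e1 : fderiv ℝ u = u' := funext fun x => (h x).fderiv
  have e2 : fderiv ℝ u' = u'' := funext fun x => (h' x).fderiv
  rw [show (2 : WithTop ℕ∞) = 1 + 1 by norm_num, contDiff_succ_iff_fderiv]
  refine ⟨fun x => (h x).differentiableAt, by simp, ?_⟩
  rw [e1, contDiff_one_iff_fderiv, e2]
  exact ⟨fun x => (h' x).differentiableAt, h''⟩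

end NewtonPotential

theorem theorem1p1 (n : ℕ) (hn : 3 ≤ n) (f : EuclideanSpace ℝ (Fin n) → ℝ)
    (hf : ContDiff ℝ 1 f)
    (hf_int : Integrable (fun y => f y / (1 + ‖y‖ ^ (n - 2))) volume)
    (hgrad_int : Integrable (fun y => (1 / (1 + ‖y‖ ^ (n - 1))) • ∇ f y) volume) :
    (∀ x, Integrable (fun y => fundamentalSolution n (x - y) * f y) volume) ∧
    ContDiff ℝ 2 (newtonPotential f) ∧
    (∀ (i j : Fin n) (x : EuclideanSpace ℝ (Fin n)),
      Integrable (fun y => partialDeriv j (fundamentalSolution n) (x - y) * partialDeriv i f y)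
        volume ∧
      partialDeriv i (partialDeriv j (newtonPotential f)) x =
        ∫ y, partialDeriv j (fundamentalSolution n) (x - y) * partialDeriv i f y) ∧
    (∀ x, Δ (newtonPotential f) x = f x) := by
  obtain ⟨m, rfl⟩ : ∃ m, n = m + 2 := ⟨n - 2, by omega⟩
  have hm0 : (m : ℝ) ≠ 0 := Nat.cast_ne_zero.2 (by omega)
  have hdim : Module.finrank ℝ (EuclideanSpace ℝ (Fin (m + 2))) = m + 2 := by simp
  have hm : m + 1 < Module.finrank ℝ (EuclideanSpace ℝ (Fin (m + 2))) := by omega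
  have : Nontrivial (EuclideanSpace ℝ (Fin (m + 2))) :=
    Module.nontrivial_of_finrank_pos (R := ℝ) (by omega)
  have hfi : Integrable (fun y => ‖f y‖ / (1 + ‖y‖ ^ m)) := by
    refine hf_int.norm.congr (.of_forall fun y => ?_)
    simp only [norm_div, Nat.add_sub_cancel]
    rw [Real.norm_of_nonneg (show 0 ≤ 1 + ‖y‖ ^ m by positivity)]
  have hfi1 := integrable_norm_div_one_add_norm_pow_succ hf.continuous hfi
  have hfi' : Integrable (fun y => ‖fderiv ℝ f y‖ / (1 + ‖y‖ ^ (m + 1))) := by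
    refine hgrad_int.norm.congr (.of_forall fun y => ?_)
    simp only [norm_smul, gradient, LinearIsometryEquiv.norm_map,
      show m + 2 - 1 = m + 1 by omega]
    rw [Real.norm_of_nonneg (by positivity), one_div_mul_eq_div]
  set c : ℝ := -1 / (((m + 2 : ℕ) - 2 : ℝ) * sphereArea (m + 2)) with hc
  have hE : fundamentalSolution (m + 2) = fun z => c * regKernel m 0 z :=
    funext (fundamentalSolution_eq_mul_regKernel m)
  have hu : newtonPotential f = fun x => c * ∫ y, f y • regKernel m 0 (x - y) := by
    ext x
    rw [newtonPotential, ← integral_const_mul]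
    simp only [hE, smul_eq_mul]
    exact integral_congr_ae (.of_forall fun y => by ring)
  have hu1 : ∀ x, HasFDerivAt (newtonPotential f) (c • ∫ y, f y • regGrad m 0 (x - y)) x := by
    intro x
    rw [hu]
    exact (hasFDerivAt_regKernel_potential hm hf.continuous hfi x).const_mul c
  have hu2 : ∀ x, HasFDerivAt (fun x => c • ∫ y, f y • regGrad m 0 (x - y))
      (c • ∫ y, (fderiv ℝ f y).smulRight (regGrad m 0 (x - y))) x := fun x =>
    (hasFDerivAt_regGrad_potential hm hf hfi1 hfi' x).const_smul c
  have hH := integrable_and_continuous_fderiv_smulRight_regGrad hm hf hfi'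
  -- Only almost everywhere: at `y = x` the kernel is singular and its derivative formula is not
  -- available.
  have hEj : ∀ (j : Fin (m + 2)) x, ∀ᵐ y, partialDeriv j (fundamentalSolution (m + 2)) (x - y) =
      c * regGrad m 0 (x - y) (EuclideanSpace.single j 1) := by
    intro j x
    filter_upwards [ae_ne_of_nontrivial x] with y hy
    rw [hE, partialDeriv_eq_of_hasFDerivAt ((hasFDerivAt_regKernel m
      (regNorm_pos_of_point 0 (sub_ne_zero.2 hy.symm)).ne').const_mul c)]
    rfl
  have hfd : ∀ y, HasFDerivAt f (fderiv ℝ f y) y := fun y =>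
    (hf.differentiable one_ne_zero y).hasFDerivAt
  refine ⟨fun x => ?_, ?_, fun i j x => ?_, fun x => ?_⟩
  · refine (((integrable_and_continuous_regKernel (by omega) hf.continuous hfi).1 0 x).const_mul
      c).congr (.of_forall fun y => ?_)
    simp only [hE, smul_eq_mul]
    ring
  · exact contDiff_two_of_hasFDerivAt hu1 hu2
      ((hH.2.comp (f := fun x => (0, x)) (by fun_prop)).const_smul c)
  · have hI := ((hH.1 0 x).apply_continuousLinearMap
      (EuclideanSpace.single i 1))
    have hI2 := (hI.apply_continuousLinearMap (EuclideanSpace.single j 1)).const_mul c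
    have hcongr : (fun y => c * (fderiv ℝ f y).smulRight (regGrad m 0 (x - y))
        (EuclideanSpace.single i 1) (EuclideanSpace.single j 1)) =ᵐ[volume]
        fun y => partialDeriv j (fundamentalSolution (m + 2)) (x - y) * partialDeriv i f y := by
      filter_upwards [hEj j x] with y hy
      rw [hy, partialDeriv_eq_of_hasFDerivAt (hfd y)]
      simp only [ContinuousLinearMap.smulRight_apply, smul_apply, smul_eq_mul]
      ring
    refine ⟨hI2.congr hcongr, ?_⟩
    have hpj : partialDeriv j (newtonPotential f) = fun x =>
        (c • ∫ y, f y • regGrad m 0 (x - y)) (EuclideanSpace.single j 1) :=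
      funext fun x => partialDeriv_eq_of_hasFDerivAt (hu1 x) j
    rw [hpj, partialDeriv_eq_of_hasFDerivAt ((hu2 x).clm_apply (hasFDerivAt_const _ x)),
      ← integral_congr_ae hcongr, integral_const_mul, ← ContinuousLinearMap.integral_apply hI,
      ← ContinuousLinearMap.integral_apply (hH.1 0 x)]
    simp
  · have e1 : fderiv ℝ (newtonPotential f) = _ := funext fun x => (hu1 x).fderiv
    rw [laplacian_eq_iteratedFDeriv_orthonormalBasis _ (EuclideanSpace.basisFun (Fin (m + 2)) ℝ)]
    simp only [iteratedFDeriv_two_apply, e1, (hu2 x).fderiv, Matrix.cons_val_zero,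
      Matrix.cons_val_one, smul_apply, smul_eq_mul, ← Finset.mul_sum]
    -- Since `sphereArea` is `(m + 2) * v` with `v` the volume of the unit ball, `c = -1 / (m (m +
    -- 2) v)` exactly inverts the factor `-(m (m + 2)) v`; `n ≥ 3` ensures `m ≠ 0`.
    rw [sum_integral_fderiv_smulRight_regGrad _ hdim hf hfi1 hfi' x, hc, sphereArea,
      Measure.toSphere_real_apply_univ, hdim]
    have hv : volume.real (Metric.ball (0 : EuclideanSpace ℝ (Fin (m + 2))) 1) ≠ 0 :=
      (ENNReal.toReal_pos (Metric.measure_ball_pos _ _ one_pos).ne' measure_ball_lt_top.ne).ne'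
    push_cast
    have hm2 : (m : ℝ) + 2 ≠ 0 := by positivity
    have hm3 : (m : ℝ) + 2 - 2 = m := by ring
    rw [hm3]
    field_simp
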